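/- A permutation is a finite word over the positive integers without repeated letters; $S_n$ is the set of permutations of $[n]=\{1,\dots,n\}$. The stack-sorting map $s$ sends the empty permutation to itself and sends $\pi=LnR$, where $n$ is the largest letter of $\pi$, to $s(L)\,s(R)\,n$. A permutation $\pi$ is \emph{sorted} if $|s^{-1}(\pi)|>0$ and \emph{uniquely sorted} if $|s^{-1}(\pi)|=1$. Let $\mathrm{Av}(\tau)$ be the set of all $\pi\in\bigcup_{n\ge 0}S_n$ that avoid the pattern $\tau$, and let $\mathcal U_n(\tau)$ be the set of uniquely sorted permutations in $S_n\cap\mathrm{Av}(\tau)$. Let $\mathrm{Des}(\pi)$ be the set of $i$ with $1\le i<n$ and $\pi_i>\pi_{i+1}$, for $\pi=\pi_1\cdots\pi_n$. For $i\in[n]$ and $\pi\in S_n$, let $L_i$ (respectively $R_i$) be the set of letters smaller than $i$ that stand to the left (respectively right) of $i$ in $\pi$. The word $\mathrm{swu}_i(\pi)$ is obtained from $\pi$ by keeping every letter $\ge i$, replacing the $m$-th smallest element of $R_i$ by $m$, and replacing the $m$-th largest element of $L_i$ by $i-m$. Put $\mathrm{swd}_i=\mathrm{rev}\circ\mathrm{swu}_i\circ\mathrm{rev}$,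 where $\mathrm{rev}$ reverses a word, and on $S_n$ put $\mathrm{swu}=\mathrm{swu}_1\circ\cdots\circ\mathrm{swu}_n$ and $\mathrm{swd}=\mathrm{swd}_1\circ\cdots\circ\mathrm{swd}_n$. Theorem. For each nonnegative integer $k$, the maps $\mathrm{swu}:\mathcal U_{2k+1}(231)\to\mathcal U_{2k+1}(132)$ and $\mathrm{swd}:\mathcal U_{2k+1}(132)\to\mathcal U_{2k+1}(231)$ are bijections that are inverses of each other. Moreover, $\mathrm{swu}:\mathrm{Av}(231)\to\mathrm{Av}(132)$ and $\mathrm{swd}:\mathrm{Av}(132)\to\mathrm{Av}(231)$ are bijections that are inverses of each other; for every $n\ge 0$ and $\pi\in S_n$ one has $\mathrm{Des}(\mathrm{swu}(\pi))=\mathrm{Des}(\mathrm{swd}(\pi))=\mathrm{Des}(\pi)$; and if $\pi\in S_n$ is sorted, then $\mathrm{swu}(\pi)$ and $\mathrm{swd}(\pi)$ are sorted. -/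

import Mathlib

namespace StackSliding

/-- A permutation is a finite word over the positive integers without repeated letters. -/
def IsPerm (w : List ℕ) : Prop := w.Nodup ∧ ∀ x ∈ w, 0 < x

/-- `S n`: the permutations of `{1, …, n}`, in one-line notation. -/
def S (n : ℕ) : Set (List ℕ) := {w | w.Perm (List.range' 1 n)}

/-! ### The stack-sorting map -/

/-- The largest letter of a word (`0` for the empty word). -/
def maxLetter (w : List ℕ) : ℕ := w.foldr max 0

/-- The letters of `w` standing to the left of (the first occurrence of) `a`. -/
def leftOf (a : ℕ) (w : List ℕ) : List ℕ := w.takeWhile (fun x => decide (x ≠ a))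

/-- The letters of `w` standing to the right of (the first occurrence of) `a`. -/
def rightOf (a : ℕ) (w : List ℕ) : List ℕ := (w.dropWhile (fun x => decide (x ≠ a))).tail

theorem maxLetter_mem : ∀ {w : List ℕ}, w ≠ [] → maxLetter w ∈ w
  | [], h => absurd rfl h
  | [a], _ => by simp [maxLetter]
  | a :: b :: l, _ => by
      have ih : maxLetter (b :: l) ∈ b :: l := maxLetter_mem (by simp)
      have e : maxLetter (a :: b :: l) = max a (maxLetter (b :: l)) := rfl
      rw [e]
      rcases max_choice a (maxLetter (b :: l)) with h | h <;> rw [h]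
      · exact List.mem_cons_self
      · exact List.mem_cons_of_mem _ ih

theorem leftOf_append_rightOf {a : ℕ} : ∀ {w : List ℕ}, a ∈ w →
    leftOf a w ++ a :: rightOf a w = w
  | b :: l, h => by
      by_cases hb : b = a
      · subst hb; simp [leftOf, rightOf]
      · have h' : a ∈ l := by
          rcases List.mem_cons.1 h with h | h
          · exact absurd h.symm hb
          · exact h
        have ih := leftOf_append_rightOf h'
        simpa [leftOf, rightOf, hb] using ih

/-- The stack-sorting map: `s` of the empty word is empty, and `s (L n R) = s L · s R · n`,
where `n` is the largest letter. -/
def stackSort (w : List ℕ) : List ℕ :=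
  if _h : w = [] then []
  else
    stackSort (leftOf (maxLetter w) w) ++ stackSort (rightOf (maxLetter w) w) ++ [maxLetter w]
termination_by w.length
decreasing_by
  all_goals
    have e := congrArg List.length (leftOf_append_rightOf (maxLetter_mem _h))
    simp only [List.length_append, List.length_cons] at e
    omega

/-- The fertility of `π`: its number of preimages under the stack-sorting map. -/
noncomputable def fertility (π : List ℕ) : ℕ∞ := {σ : List ℕ | IsPerm σ ∧ stackSort σ = π}.encard

/-- A permutation is sorted if its fertility is positive. -/
def Sorted (π : List ℕ) : Prop := 0 < fertility π

/-- A permutation is uniquely sorted if its fertility is `1`. -/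
def UniquelySorted (π : List ℕ) : Prop := fertility π = 1

/-! ### Patterns and descents -/

/-- Replace the `i`-th smallest letter by `i`, for every `i`. -/
def normalize (w : List ℕ) : List ℕ := w.map (fun x => w.countP (fun y => decide (y ≤ x)))

/-- `σ` contains `τ` if some subword `σ_{i₁} ⋯ σ_{iₘ}`, `i₁ < ⋯ < iₘ`, has the same relative
order as `τ`. -/
def Contains (σ τ : List ℕ) : Prop := ∃ u, List.Sublist u σ ∧ normalize u = normalize τ

/-- The normalized permutations (of any length) avoiding `τ`. -/
def Av (τ : List ℕ) : Set (List ℕ) := {π | (∃ n, π ∈ S n) ∧ ¬ Contains π τ}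

/-- The uniquely sorted permutations in `S n` avoiding `τ`. -/
def U (n : ℕ) (τ : List ℕ) : Set (List ℕ) := {π | π ∈ S n ∧ UniquelySorted π ∧ π ∈ Av τ}

/-- The set of descents of `π = π₁ ⋯ πₙ`: the `i ∈ {1, …, n - 1}` with `πᵢ > πᵢ₊₁`. -/
def Des (π : List ℕ) : Finset ℕ :=
  {i ∈ Finset.Icc 1 (π.length - 1) | π.getD (i - 1) 0 > π.getD i 0}

/-! ### The sliding operators -/

/-- The operator `swu_i` on `S n` (for `1 ≤ i ≤ n`). Let `L` (resp. `R`) be the set of letters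
smaller than `i` to the left (resp. right) of `i`. Letters `≥ i` stay, the `m`-th smallest
element of `R` becomes `m`, and the `m`-th largest element of `L` becomes `i - m`. -/
def swuAt (i : ℕ) (π : List ℕ) : List ℕ :=
  let L := (leftOf i π).filter (fun x => decide (x < i))
  let R := (rightOf i π).filter (fun x => decide (x < i))
  π.map (fun x =>
    if i ≤ x then x
    else if x ∈ R then R.countP (fun y => decide (y ≤ x))
    else i - L.countP (fun y => decide (x ≤ y)))

/-- `swd_i = rev ∘ swu_i ∘ rev`. -/
def swdAt (i : ℕ) (π : List ℕ) : List ℕ := (swuAt i π.reverse).reverse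

/-- `swu = swu_1 ∘ swu_2 ∘ ⋯ ∘ swu_n` on `S n`. -/
def swu (π : List ℕ) : List ℕ := (List.range' 1 π.length).foldr swuAt π

/-- `swd = swd_1 ∘ swd_2 ∘ ⋯ ∘ swd_n` on `S n`. -/
def swd (π : List ℕ) : List ℕ := (List.range' 1 π.length).foldr swdAt π

end StackSliding

namespace StackSliding

/-! A permutation has a decreasing binary tree; forgetting the labels leaves its shape, recorded
here as which intervals of positions have their maximum at the left or the right end. The descent
set and the fertility depend only on the shape (`SameShape.des_eq`, `SameShape.fertility_eq`). For
fertility, a preimage of a word ending in its maximum is a splitting of the rest together with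
preimages of both parts, and shape passes to factors.

Each `swuAt i` preserves the shape: it never destroys an inversion, and the only new ones are
between two letters below `i` with `i` between them, a pair whose interval has its maximum at
neither end. It also removes every 132 whose largest letter is `i`, and later operators, with
smaller index, do not restore one. So `swu` yields a 132-avoiding word of the same shape, and by
reversal `swd` yields a 231-avoiding one (`swu_spec`, `swd_spec`).

A shape contains at most one 132-avoiding and at most one 231-avoiding permutation
(`SameShape.eq_of_avoids132` and its reversal). Hence each composite is the identity on the relevant
avoidance class, and equality of fertilities restricts the bijections to uniquely sorted
permutations. -/

theorem S.length_eq {n : ℕ} {w : List ℕ} (h : w ∈ S n) : w.length = n := by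
  simpa using List.Perm.length_eq h

theorem S.nodup {n : ℕ} {w : List ℕ} (h : w ∈ S n) : w.Nodup :=
  (List.Perm.nodup_iff h).2 List.nodup_range'

theorem S.mem_iff {n : ℕ} {w : List ℕ} (h : w ∈ S n) {x : ℕ} : x ∈ w ↔ 1 ≤ x ∧ x ≤ n := by
  rw [List.Perm.mem_iff h, List.mem_range'_1]; omega

theorem S.isPerm {n : ℕ} {w : List ℕ} (h : w ∈ S n) : IsPerm w :=
  ⟨S.nodup h, fun _ hx => ((S.mem_iff h).1 hx).1⟩

theorem mem_S_of_nodup {n : ℕ} {w : List ℕ} (hn : w.Nodup) (hl : w.length = n)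
    (hm : ∀ x ∈ w, 1 ≤ x ∧ x ≤ n) : w ∈ S n := by
  refine List.Subperm.perm_of_length_le (List.subperm_of_subset hn ?_) (by simp [hl])
  intro x hx
  rw [List.mem_range'_1]
  have := hm x hx
  omega

theorem S.reverse {n : ℕ} {w : List ℕ} (h : w ∈ S n) : w.reverse ∈ S n :=
  (List.reverse_perm w).trans h

theorem S.countP_lt {n : ℕ} {w : List ℕ} (h : w ∈ S n) {i : ℕ} (h1 : 1 ≤ i) (hn : i ≤ n) :
    w.countP (fun x => decide (x < i)) = i - 1 := by
  rw [List.Perm.countP_eq _ h]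
  have e : List.range' 1 n = List.range' 1 (i - 1) ++ List.range' i (n - i + 1) := by
    have := List.range'_append (s := 1) (m := i - 1) (n := n - i + 1) (step := 1)
    rw [show 1 + 1 * (i - 1) = i by omega, show i - 1 + (n - i + 1) = n by omega] at this
    exact this.symm
  rw [e, List.countP_append, List.countP_eq_length.2, List.countP_eq_zero.2]
  · simp
  · intro x hx; rw [List.mem_range'_1] at hx; simp; omega
  · intro x hx; rw [List.mem_range'_1] at hx; simp; omega

/-- The letter of `w` in position `k`, counted from `0`. -/
abbrev letter (w : List ℕ) (k : ℕ) : ℕ := w.getD k 0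

theorem letter_eq_getElem {w : List ℕ} {k : ℕ} (h : k < w.length) : letter w k = w[k] := by
  simp [letter, h]

theorem letter_mem {w : List ℕ} {k : ℕ} (h : k < w.length) : letter w k ∈ w := by
  rw [letter_eq_getElem h]; exact List.getElem_mem h

theorem exists_letter_eq {w : List ℕ} {x : ℕ} (h : x ∈ w) : ∃ k < w.length, letter w k = x := by
  obtain ⟨k, hk, e⟩ := List.getElem_of_mem h
  exact ⟨k, hk, by rw [letter_eq_getElem hk, e]⟩

theorem letter_map {f : ℕ → ℕ} {w : List ℕ} {k : ℕ} (h : k < w.length) :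
    letter (w.map f) k = f (letter w k) := by
  simp [letter, h]

theorem letter_inj {w : List ℕ} (hw : w.Nodup) {p q : ℕ} (hp : p < w.length) (hq : q < w.length)
    (h : letter w p = letter w q) : p = q := by
  rw [letter_eq_getElem hp, letter_eq_getElem hq] at h
  exact (List.Nodup.getElem_inj_iff hw).1 h

theorem letter_reverse {w : List ℕ} {k : ℕ} (h : k < w.length) :
    letter w.reverse k = letter w (w.length - 1 - k) := by
  rw [letter_eq_getElem (by simpa using h), letter_eq_getElem (by omega), List.getElem_reverse]

theorem letter_append_left {A B : List ℕ} {k : ℕ} (h : k < A.length) :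
    letter (A ++ B) k = letter A k := by
  simp [letter, List.getElem?_append_left h]

theorem letter_append_right {A B : List ℕ} (k : ℕ) :
    letter (A ++ B) (A.length + k) = letter B k := by
  simp [letter, List.getElem?_append_right]

/-! ### Shapes of words -/

/-- Two words have the same shape if the same positions carry the left (resp. right) end maximum
of each interval of positions; equivalently, if their decreasing binary trees have the same
shape. -/
def SameShape (w v : List ℕ) : Prop :=
  w.length = v.length ∧ ∀ p q, p < q → q < w.length →
    ((∀ k, p ≤ k → k < q → letter w k < letter w q) ↔
      (∀ k, p ≤ k → k < q → letter v k < letter v q)) ∧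
    ((∀ k, p < k → k ≤ q → letter w k < letter w p) ↔
      (∀ k, p < k → k ≤ q → letter v k < letter v p))

theorem SameShape.refl (w : List ℕ) : SameShape w w := ⟨rfl, fun _ _ _ _ => ⟨Iff.rfl, Iff.rfl⟩⟩

theorem SameShape.symm {w v : List ℕ} (h : SameShape w v) : SameShape v w :=
  ⟨h.1.symm, fun p q hpq hq =>
    ⟨(h.2 p q hpq (h.1 ▸ hq)).1.symm, (h.2 p q hpq (h.1 ▸ hq)).2.symm⟩⟩

theorem SameShape.trans {w v u : List ℕ} (h : SameShape w v) (h' : SameShape v u) :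
    SameShape w u :=
  ⟨h.1.trans h'.1, fun p q hpq hq =>
    ⟨(h.2 p q hpq hq).1.trans (h'.2 p q hpq (h.1 ▸ hq)).1,
      (h.2 p q hpq hq).2.trans (h'.2 p q hpq (h.1 ▸ hq)).2⟩⟩

theorem forall_letter_reverse_iff {w : List ℕ} {p q : ℕ} (hpq : p < q) (hq : q < w.length) :
    ((∀ k, p ≤ k → k < q → letter w.reverse k < letter w.reverse q) ↔
      (∀ k, w.length - 1 - q < k → k ≤ w.length - 1 - p →
        letter w k < letter w (w.length - 1 - q))) ∧
    ((∀ k, p < k → k ≤ q → letter w.reverse k < letter w.reverse p) ↔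
      (∀ k, w.length - 1 - q ≤ k → k < w.length - 1 - p →
        letter w k < letter w (w.length - 1 - p))) := by
  refine ⟨⟨fun h k h1 h2 => ?_, fun h k h1 h2 => ?_⟩, ⟨fun h k h1 h2 => ?_, fun h k h1 h2 => ?_⟩⟩
  · have := h (w.length - 1 - k) (by omega) (by omega)
    rw [letter_reverse (by omega), letter_reverse hq] at this
    rwa [show w.length - 1 - (w.length - 1 - k) = k by omega] at this
  · rw [letter_reverse (by omega), letter_reverse hq]
    exact h _ (by omega) (by omega)
  · have := h (w.length - 1 - k) (by omega) (by omega)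
    rw [letter_reverse (by omega), letter_reverse (by omega)] at this
    rwa [show w.length - 1 - (w.length - 1 - k) = k by omega] at this
  · rw [letter_reverse (by omega), letter_reverse (by omega)]
    exact h _ (by omega) (by omega)

theorem SameShape.reverse {w v : List ℕ} (h : SameShape w v) :
    SameShape w.reverse v.reverse := by
  refine ⟨by simpa using h.1, fun p q hpq hq => ?_⟩
  rw [List.length_reverse] at hq
  have hq' : q < v.length := h.1 ▸ hq
  have key := h.2 (w.length - 1 - q) (w.length - 1 - p) (by omega) (by omega)
  rw [(forall_letter_reverse_iff hpq hq).1, (forall_letter_reverse_iff hpq hq).2,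
    (forall_letter_reverse_iff hpq hq').1, (forall_letter_reverse_iff hpq hq').2, ← h.1]
  exact ⟨key.2, key.1⟩

/-- An interval of positions inside one factor sees only the letters of that factor. -/
theorem SameShape.of_append {A B A' B' : List ℕ} (h : SameShape (A ++ B) (A' ++ B'))
    (hl : A.length = A'.length) : SameShape A A' ∧ SameShape B B' := by
  have hl2 : B.length = B'.length := by
    have := h.1
    simp only [List.length_append] at this
    omega
  constructor
  · refine ⟨hl, fun p q hpq hq => ?_⟩
    have key := h.2 p q hpq (by simp only [List.length_append]; omega)
    have e : ∀ k, k ≤ q → letter (A ++ B) k = letter A k :=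
      fun k hk => letter_append_left (by omega)
    have e' : ∀ k, k ≤ q → letter (A' ++ B') k = letter A' k :=
      fun k hk => letter_append_left (by omega)
    have s : ∀ (w v : List ℕ), (∀ k, k ≤ q → letter w k = letter v k) →
        ((∀ k, p ≤ k → k < q → letter w k < letter w q) ↔
          (∀ k, p ≤ k → k < q → letter v k < letter v q)) ∧
        ((∀ k, p < k → k ≤ q → letter w k < letter w p) ↔
          (∀ k, p < k → k ≤ q → letter v k < letter v p)) := by
      intro w v hwv
      constructor
      · refine forall_congr' fun k => forall_congr' fun _ => forall_congr' fun h2 => ?_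
        rw [hwv k (by omega), hwv q le_rfl]
      · refine forall_congr' fun k => forall_congr' fun _ => forall_congr' fun h2 => ?_
        rw [hwv k (by omega), hwv p (by omega)]
    rw [(s _ _ e).1, (s _ _ e).2, (s _ _ e').1, (s _ _ e').2] at key
    exact key
  · refine ⟨hl2, fun p q hpq hq => ?_⟩
    have key := h.2 (A.length + p) (A.length + q) (by omega)
      (by simp only [List.length_append]; omega)
    have s : ∀ (C D : List ℕ),
        ((∀ k, C.length + p ≤ k → k < C.length + q →
            letter (C ++ D) k < letter (C ++ D) (C.length + q)) ↔
          (∀ k, p ≤ k → k < q → letter D k < letter D q)) ∧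
        ((∀ k, C.length + p < k → k ≤ C.length + q →
            letter (C ++ D) k < letter (C ++ D) (C.length + p)) ↔
          (∀ k, p < k → k ≤ q → letter D k < letter D p)) := by
      intro C D
      rw [letter_append_right, letter_append_right]
      refine ⟨⟨fun H k h1 h2 => ?_, fun H k h1 h2 => ?_⟩,
        ⟨fun H k h1 h2 => ?_, fun H k h1 h2 => ?_⟩⟩
      · simpa only [letter_append_right] using H (C.length + k) (by omega) (by omega)
      · obtain ⟨j, rfl⟩ := Nat.exists_eq_add_of_le (show C.length ≤ k by omega)
        rw [letter_append_right]
        exact H j (by omega) (by omega)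
      · simpa only [letter_append_right] using H (C.length + k) (by omega) (by omega)
      · obtain ⟨j, rfl⟩ := Nat.exists_eq_add_of_le (show C.length ≤ k by omega)
        rw [letter_append_right]
        exact H j (by omega) (by omega)
    have s' := s A' B'
    rw [← hl] at s'
    rw [(s A B).1, (s A B).2, s'.1, s'.2] at key
    exact key

/-- Apply the right-end condition to the intervals that end at the last position. -/
theorem SameShape.last_max {A A' : List ℕ} {a a' : ℕ} (h : SameShape (A ++ [a]) (A' ++ [a']))
    (hA : ∀ x ∈ A, x < a) : ∀ x ∈ A', x < a' := by
  have hl : A.length = A'.length := by simpa using h.1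
  intro x hx
  obtain ⟨k, hk, rfl⟩ := exists_letter_eq hx
  have e : ∀ (B : List ℕ) (b : ℕ), letter (B ++ [b]) B.length = b := fun B b => by simp [letter]
  have key := (h.2 k A.length (by omega) (by simp)).1.1 (fun j _ hj => by
    rw [e, letter_append_left hj]
    exact hA _ (letter_mem hj)) k le_rfl (by omega)
  rwa [hl, e, letter_append_left hk] at key

/-- A descent is the left-end condition for an interval of two positions. -/
theorem SameShape.des_eq {w v : List ℕ} (h : SameShape w v) : Des w = Des v := by
  unfold Des
  rw [← h.1]
  refine Finset.filter_congr fun i hi => ?_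
  rw [Finset.mem_Icc] at hi
  -- Descents count positions from 1, `letter` from 0.
  have key := (h.2 (i - 1) i (by omega) (by omega)).2
  have s : ∀ u : List ℕ, (∀ k, i - 1 < k → k ≤ i → letter u k < letter u (i - 1)) ↔
      u.getD (i - 1) 0 > u.getD i 0 := fun u =>
    ⟨fun H => H i (by omega) le_rfl, fun H k h1 h2 => by
      obtain rfl : k = i := by omega
      exact H⟩
  rwa [s, s] at key

/-! ### Stack-sorting and fertility -/

theorem stackSort_nil : stackSort [] = [] := by rw [stackSort]; simp

theorem le_maxLetter {w : List ℕ} {x : ℕ} (h : x ∈ w) : x ≤ maxLetter w := by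
  induction w with
  | nil => simp at h
  | cons a l ih =>
    have e : maxLetter (a :: l) = max a (maxLetter l) := rfl
    rw [e]
    rcases List.mem_cons.1 h with rfl | h
    · exact le_max_left _ _
    · exact (ih h).trans (le_max_right _ _)

theorem leftOf_append_cons {L R : List ℕ} {a : ℕ} (h : a ∉ L) : leftOf a (L ++ a :: R) = L := by
  induction L with
  | nil => simp [leftOf]
  | cons b l ih =>
    rw [List.mem_cons, not_or] at h
    have ih := ih h.2
    simp only [leftOf] at ih ⊢
    rw [List.cons_append, List.takeWhile_cons_of_pos (by simpa using Ne.symm h.1), ih]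

theorem rightOf_append_cons {L R : List ℕ} {a : ℕ} (h : a ∉ L) : rightOf a (L ++ a :: R) = R := by
  have e := leftOf_append_rightOf (a := a) (w := L ++ a :: R) (by simp)
  rw [leftOf_append_cons h] at e
  simpa using e

theorem stackSort_append_cons {L R : List ℕ} {a : ℕ} (hL : ∀ x ∈ L, x < a) (hR : ∀ x ∈ R, x < a) :
    stackSort (L ++ a :: R) = stackSort L ++ stackSort R ++ [a] := by
  have hm : maxLetter (L ++ a :: R) = a := by
    refine le_antisymm ?_ (le_maxLetter (by simp))
    have := maxLetter_mem (w := L ++ a :: R) (by simp)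
    rcases List.mem_append.1 this with h | h
    · exact (hL _ h).le
    · rcases List.mem_cons.1 h with h | h
      · exact h.le
      · exact (hR _ h).le
  have ha : a ∉ L := fun h => lt_irrefl _ (hL a h)
  rw [stackSort, dif_neg (by simp), hm, leftOf_append_cons ha, rightOf_append_cons ha]

theorem exists_eq_append_max {w : List ℕ} (hw : w.Nodup) (h : w ≠ []) :
    ∃ L a R, w = L ++ a :: R ∧ (∀ x ∈ L, x < a) ∧ ∀ x ∈ R, x < a := by
  have e := leftOf_append_rightOf (maxLetter_mem h)
  refine ⟨_, _, _, e.symm, fun x hx => ?_, fun x hx => ?_⟩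
  · refine lt_of_le_of_ne (le_maxLetter ?_) ?_
    · rw [← e]; simp [hx]
    · rintro rfl
      rw [← e] at hw
      exact (List.nodup_append.1 hw).2.2 _ hx _ List.mem_cons_self rfl
  · refine lt_of_le_of_ne (le_maxLetter ?_) ?_
    · rw [← e]; simp [hx]
    · rintro rfl
      rw [← e] at hw
      exact (List.nodup_cons.1 (List.nodup_append.1 hw).2.1).1 hx

theorem stackSort_perm {w : List ℕ} (hw : w.Nodup) : (stackSort w).Perm w := by
  induction hn : w.length using Nat.strong_induction_on generalizing w with
  | _ n ih =>
    by_cases h : w = []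
    · subst h; rw [stackSort_nil]
    · obtain ⟨L, a, R, rfl, hL, hR⟩ := exists_eq_append_max hw h
      rw [stackSort_append_cons hL hR]
      simp only [List.length_append, List.length_cons] at hn
      have h1 := ih L.length (by omega) (List.nodup_append.1 hw).1 rfl
      have h2 := ih R.length (by omega) (List.nodup_cons.1 (List.nodup_append.1 hw).2.1).2 rfl
      rw [List.append_assoc]
      exact h1.append ((List.perm_append_singleton a _).trans (h2.cons a))

/-- The preimages of `w` under the stack-sorting map. -/
def preimages (w : List ℕ) : Set (List ℕ) := {σ | IsPerm σ ∧ stackSort σ = w}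

theorem preimages.perm {w σ : List ℕ} (h : σ ∈ preimages w) : w.Perm σ :=
  h.2 ▸ stackSort_perm h.1.1

/-- Every nonempty image of the stack-sorting map ends in its largest letter. -/
theorem preimages_eq_empty {A : List ℕ} {a : ℕ} (h : ¬ ∀ x ∈ A, x < a) :
    preimages (A ++ [a]) = ∅ := by
  rw [Set.eq_empty_iff_forall_notMem]
  intro σ hσ
  have hne : σ ≠ [] := by
    rintro rfl
    simpa using (preimages.perm hσ).length_eq
  obtain ⟨L, b, R, rfl, hL, hR⟩ := exists_eq_append_max hσ.1.1 hne
  have e := hσ.2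
  rw [stackSort_append_cons hL hR] at e
  obtain ⟨e1, e2⟩ := List.append_inj' e rfl
  obtain rfl : b = a := by simpa using e2
  apply h
  rw [← e1]
  intro x hx
  have hn := List.nodup_append.1 hσ.1.1
  rcases List.mem_append.1 hx with hx | hx
  · exact hL x ((stackSort_perm hn.1).mem_iff.1 hx)
  · exact hR x ((stackSort_perm (List.nodup_cons.1 hn.2.1).2).mem_iff.1 hx)

theorem append_cons_mem_preimages {A L R : List ℕ} {a k : ℕ} (hA : ∀ x ∈ A, x < a)
    (hp : IsPerm (A ++ [a])) (hL : L ∈ preimages (A.take k)) (hR : R ∈ preimages (A.drop k)) :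
    L ++ a :: R ∈ preimages (A ++ [a]) := by
  have pL := preimages.perm hL
  have pR := preimages.perm hR
  have p : (L ++ a :: R).Perm (A ++ [a]) := by
    have : (L ++ R).Perm A := by
      have := pL.symm.append pR.symm
      rwa [List.take_append_drop] at this
    exact List.perm_middle.trans ((this.cons a).trans (List.perm_append_singleton a A).symm)
  refine ⟨⟨p.nodup_iff.2 hp.1, fun x hx => hp.2 x (p.mem_iff.1 hx)⟩, ?_⟩
  rw [stackSort_append_cons, hL.2, hR.2, List.take_append_drop]
  · exact fun x hx => hA x (List.mem_of_mem_take (pL.mem_iff.2 hx))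
  · exact fun x hx => hA x (List.mem_of_mem_drop (pR.mem_iff.2 hx))

/-- A preimage of `A a`, with `a` the largest letter, is a splitting of `A` with a preimage of
each of the two parts. -/
noncomputable def preimagesEquiv {A : List ℕ} {a : ℕ} (hA : ∀ x ∈ A, x < a)
    (hp : IsPerm (A ++ [a])) :
    (Σ k : Fin (A.length + 1), preimages (A.take k) × preimages (A.drop k)) ≃
      preimages (A ++ [a]) :=
  Equiv.ofBijective
    (fun z => ⟨z.2.1.1 ++ a :: z.2.2.1, append_cons_mem_preimages hA hp z.2.1.2 z.2.2.2⟩) <| by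
    constructor
    · rintro ⟨k, ⟨L, hL⟩, ⟨R, hR⟩⟩ ⟨k', ⟨L', hL'⟩, ⟨R', hR'⟩⟩ h
      have e : L ++ a :: R = L' ++ a :: R' := congrArg Subtype.val h
      have aux : ∀ {M : List ℕ} {j : ℕ}, M ∈ preimages (A.take j) → a ∉ M := fun hM ha =>
        lt_irrefl a (hA a (List.mem_of_mem_take ((preimages.perm hM).mem_iff.2 ha)))
      have e1 : L = L' := by
        rw [← leftOf_append_cons (R := R) (aux hL), e, leftOf_append_cons (aux hL')]
      subst e1
      have e2 : R = R' := by simpa using e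
      subst e2
      -- The splitting point is recovered as the length of the left part.
      have e3 : k = k' := by
        have h1 := (preimages.perm hL).length_eq
        have h2 := (preimages.perm hL').length_eq
        rw [List.length_take] at h1 h2
        apply Fin.ext
        have := k.2
        have := k'.2
        omega
      subst e3
      rfl
    · rintro ⟨σ, hσ⟩
      have hne : σ ≠ [] := by
        rintro rfl
        simpa using (preimages.perm hσ).length_eq
      obtain ⟨L, b, R, rfl, hL, hR⟩ := exists_eq_append_max hσ.1.1 hne
      have e := hσ.2
      rw [stackSort_append_cons hL hR] at e
      obtain ⟨e1, e2⟩ := List.append_inj' e rfl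
      obtain rfl : b = a := by simpa using e2
      have hn := List.nodup_append.1 hσ.1.1
      have hk : (stackSort L).length < A.length + 1 := by
        rw [← e1, List.length_append]; omega
      refine ⟨⟨⟨_, hk⟩, ⟨L, ⟨hn.1, fun x hx => hσ.1.2 x (by simp [hx])⟩, ?_⟩,
        ⟨R, ⟨(List.nodup_cons.1 hn.2.1).2, fun x hx => hσ.1.2 x (by simp [hx])⟩, ?_⟩⟩, rfl⟩
      · simp [← e1]
      · simp [← e1]

theorem IsPerm.sublist {w v : List ℕ} (hw : IsPerm w) (h : v.Sublist w) : IsPerm v :=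
  ⟨hw.1.sublist h, fun x hx => hw.2 x (h.subset hx)⟩

/-- Induction on length: whether the last letter is the maximum is visible in the shape. If it is,
cutting both words at the same `k` gives parts of equal shape, so the decompositions match summand
by summand; otherwise both preimage sets are empty. -/
theorem SameShape.nonempty_preimages_equiv {w v : List ℕ} (h : SameShape w v) (hw : IsPerm w)
    (hv : IsPerm v) : Nonempty (preimages w ≃ preimages v) := by
  induction hn : w.length using Nat.strong_induction_on generalizing w v with
  | _ n ih =>
    rcases List.eq_nil_or_concat' w with rfl | ⟨A, a, rfl⟩
    · obtain rfl : v = [] := List.length_eq_zero_iff.1 (by simpa using h.1.symm)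
      exact ⟨Equiv.refl _⟩
    · rcases List.eq_nil_or_concat' v with rfl | ⟨B, b, rfl⟩
      · simpa using h.1
      have hl : A.length = B.length := by simpa using h.1
      by_cases hA : ∀ x ∈ A, x < a
      · have hB := h.last_max hA
        have hAB := (h.of_append hl).1
        have key : ∀ k : Fin (A.length + 1), Nonempty
            (preimages (A.take k) × preimages (A.drop k) ≃
              preimages (B.take k) × preimages (B.drop k)) := by
          intro k
          have hs : SameShape (A.take k ++ A.drop k) (B.take k ++ B.drop k) := by
            simpa only [List.take_append_drop] using hAB
          obtain ⟨s1, s2⟩ := hs.of_append (by simp [hl])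
          have hA' := hw.sublist (List.sublist_append_left A [a])
          have hB' := hv.sublist (List.sublist_append_left B [b])
          rw [List.length_append, List.length_singleton] at hn
          obtain ⟨e1⟩ := ih (A.take k).length (by rw [List.length_take]; omega) s1
            (hA'.sublist (List.take_sublist _ _)) (hB'.sublist (List.take_sublist _ _)) rfl
          obtain ⟨e2⟩ := ih (A.drop k).length (by rw [List.length_drop]; omega) s2
            (hA'.sublist (List.drop_sublist _ _)) (hB'.sublist (List.drop_sublist _ _)) rfl
          exact ⟨e1.prodCongr e2⟩
        exact ⟨(preimagesEquiv hA hw).symm.trans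
          ((Equiv.sigmaCongr (finCongr (by rw [hl])) fun k => (key k).some).trans
            (preimagesEquiv hB hv))⟩
      · have hB : ¬ ∀ x ∈ B, x < b := fun hB => hA (h.symm.last_max hB)
        rw [preimages_eq_empty hA, preimages_eq_empty hB]
        exact ⟨Equiv.refl _⟩

theorem SameShape.fertility_eq {w v : List ℕ} (h : SameShape w v) (hw : IsPerm w)
    (hv : IsPerm v) : fertility w = fertility v := by
  obtain ⟨e⟩ := h.nonempty_preimages_equiv hw hv
  exact Set.encard_congr e

/-! ### Effect of one sliding operator -/

theorem countP_lt_countP {α : Type*} {p q : α → Bool} {l : List α} (h : ∀ x ∈ l, p x → q x) {a : α}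
    (ha : a ∈ l) (hq : q a) (hp : ¬ p a) : l.countP p < l.countP q := by
  obtain ⟨s, t, rfl⟩ := List.append_of_mem ha
  have h1 : s.countP p ≤ s.countP q := List.countP_mono_left fun x hx => h x (by simp [hx])
  have h2 : t.countP p ≤ t.countP q := List.countP_mono_left fun x hx => h x (by simp [hx])
  rw [List.countP_append, List.countP_append, List.countP_cons_of_neg hp,
    List.countP_cons_of_pos hq]
  omega

/-- How `swuAt i` acts on a permutation `A i B` of `[n]`: it fixes the letters `≥ i`, permutes the
letters `< i` increasingly on each side of `i`, and moves those of `A` above those of `B`. -/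
theorem swuAt_eq_map {n i : ℕ} {w : List ℕ} (hw : w ∈ S n) (h1 : 1 ≤ i) (hn : i ≤ n) :
    ∃ (A B : List ℕ) (f : ℕ → ℕ), w = A ++ i :: B ∧ swuAt i w = w.map f ∧
      (∀ x, i ≤ x → f x = x) ∧
      (∀ x ∈ w, x < i → 1 ≤ f x ∧ f x < i) ∧
      (∀ x ∈ A, ∀ y ∈ A, x < y → y < i → f x < f y) ∧
      (∀ x ∈ B, ∀ y ∈ B, x < y → y < i → f x < f y) ∧
      (∀ x ∈ A, ∀ y ∈ B, x < i → y < i → f y < f x) := by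
  have hi : i ∈ w := (S.mem_iff hw).2 ⟨h1, hn⟩
  have e := leftOf_append_rightOf hi
  set A := leftOf i w with hA
  set B := rightOf i w with hB
  set L := A.filter (fun x => decide (x < i)) with hL
  set R := B.filter (fun x => decide (x < i)) with hR
  have hnd := S.nodup hw
  rw [← e] at hnd
  have hdisj := (List.nodup_append.1 hnd).2.2
  -- This count separates the two sides: letters of `R` get values up to `R.length`, those of `L`
  -- get values above it and below `i`.
  have hc : L.length + R.length = i - 1 := by
    rw [← S.countP_lt hw h1 hn, ← e, List.countP_append, List.countP_cons_of_neg (by simp), hL, hR,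
      List.countP_eq_length_filter, List.countP_eq_length_filter]
  have memL : ∀ {x}, x ∈ L ↔ x ∈ A ∧ x < i := by simp [hL]
  have memR : ∀ {x}, x ∈ R ↔ x ∈ B ∧ x < i := by simp [hR]
  let f : ℕ → ℕ := fun x =>
    if i ≤ x then x
    else if x ∈ R then R.countP (fun y => decide (y ≤ x))
    else i - L.countP (fun y => decide (x ≤ y))
  have fA : ∀ x ∈ A, x < i → f x = i - L.countP (fun y => decide (x ≤ y)) := by
    intro x hx hxi
    have : x ∉ R := fun h => hdisj x hx x (List.mem_cons_of_mem _ (memR.1 h).1) rfl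
    simp only [f, if_neg (not_le.2 hxi), if_neg this]
  have fB : ∀ x ∈ B, x < i → f x = R.countP (fun y => decide (y ≤ x)) := by
    intro x hx hxi
    simp only [f, if_neg (not_le.2 hxi), if_pos (memR.2 ⟨hx, hxi⟩)]
  have bA : ∀ x ∈ A, x < i → R.length < f x ∧ f x < i := by
    intro x hx hxi
    rw [fA x hx hxi]
    have h2 : L.countP (fun y => decide (x ≤ y)) ≤ L.length := List.countP_le_length
    have h3 : 0 < L.countP (fun y => decide (x ≤ y)) :=
      List.countP_pos_iff.2 ⟨x, memL.2 ⟨hx, hxi⟩, by simp⟩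
    omega
  have bB : ∀ x ∈ B, x < i → 1 ≤ f x ∧ f x ≤ R.length := by
    intro x hx hxi
    rw [fB x hx hxi]
    exact ⟨List.countP_pos_iff.2 ⟨x, memR.2 ⟨hx, hxi⟩, by simp⟩, List.countP_le_length⟩
  refine ⟨A, B, f, e.symm, rfl, fun x hx => by simp only [f, if_pos hx], ?_, ?_, ?_, ?_⟩
  · intro x hx hxi
    rw [← e] at hx
    rcases List.mem_append.1 hx with hx | hx
    · have := bA x hx hxi
      omega
    · rcases List.mem_cons.1 hx with hx | hx
      · omega
      · have := bB x hx hxi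
        omega
  · intro x hx y hy hxy hyi
    have b1 := bA x hx (by omega)
    have b2 := bA y hy hyi
    rw [fA x hx (by omega)] at b1 ⊢
    rw [fA y hy hyi] at b2 ⊢
    have : L.countP (fun z => decide (y ≤ z)) < L.countP (fun z => decide (x ≤ z)) :=
      countP_lt_countP (fun z _ hz => by simp only [decide_eq_true_eq] at hz ⊢; omega)
        (memL.2 ⟨hx, by omega⟩) (by simp) (by simpa using hxy)
    omega
  · intro x hx y hy hxy hyi
    rw [fB x hx (by omega), fB y hy hyi]
    exact countP_lt_countP (fun z _ hz => by simp only [decide_eq_true_eq] at hz ⊢; omega)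
      (memR.2 ⟨hy, hyi⟩) (by simp) (by simpa using hxy)
  · intro x hx y hy hxi hyi
    have := bA x hx hxi
    have := bB y hy hyi
    omega

/-- The effect of `swuAt i` on the relative order of letters, by positions. -/
structure IsSlide (i : ℕ) (w v : List ℕ) : Prop where
  length_eq : w.length = v.length
  fixed : ∀ k < w.length, i ≤ letter w k → letter v k = letter w k
  lt : ∀ k < w.length, letter w k < i → letter v k < i
  inv : ∀ p q, p < q → q < w.length → letter w q < letter w p → letter v q < letter v p
  noninv : ∀ p q, p < q → q < w.length → letter w p < letter w q →
    letter v p < letter v q ∨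
      ∃ r, p < r ∧ r < q ∧ letter w r = i ∧ letter w p < i ∧ letter w q < i
  separated : ∀ p r q, p < r → r < q → q < w.length → letter w r = i → letter w p < i →
    letter w q < i → letter v q < letter v p

theorem isSlide_swuAt {n i : ℕ} {w : List ℕ} (hw : w ∈ S n) (h1 : 1 ≤ i) (hn : i ≤ n) :
    IsSlide i w (swuAt i w) ∧ swuAt i w ∈ S n := by
  obtain ⟨A, B, f, e, hs, hfix, hlt, hA, hB, hAB⟩ := swuAt_eq_map hw h1 hn
  have hnd := S.nodup hw
  have hlen : w.length = A.length + (B.length + 1) := by rw [e]; simp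
  have memA : ∀ k, k < A.length → letter w k ∈ A := fun k hk => by
    rw [e, letter_append_left hk]; exact letter_mem hk
  have memB : ∀ k, A.length < k → k < w.length → letter w k ∈ B := fun k hk hk' => by
    obtain ⟨j, rfl⟩ := Nat.exists_eq_add_of_le (show A.length + 1 ≤ k from hk)
    have : letter w (A.length + 1 + j) = letter B j := by
      rw [e, add_assoc, letter_append_right, add_comm 1 j]; simp [letter]
    rw [this]
    exact letter_mem (by omega)
  have eqi : letter w A.length = i := by
    rw [e]; simp [letter]
  have posi : ∀ k, k < w.length → letter w k = i → k = A.length := fun k hk h =>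
    letter_inj hnd hk (by omega) (h.trans eqi.symm)
  have hv : ∀ k, k < w.length → letter (swuAt i w) k = f (letter w k) := fun k hk => by
    rw [hs, letter_map hk]
  have inv : ∀ p q, p < q → q < w.length → letter w q < letter w p →
      f (letter w q) < f (letter w p) := by
    intro p q hpq hq h
    rcases le_or_gt i (letter w q) with c | c
    · rw [hfix _ c, hfix _ (by omega)]; exact h
    · rcases le_or_gt i (letter w p) with d | d
      · rw [hfix _ d]; have := hlt _ (letter_mem hq) c; omega
      · have hpA : p ≠ A.length := by rintro rfl; omega
        have hqA : q ≠ A.length := by rintro rfl; omega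
        rcases lt_or_gt_of_ne hqA with h2 | h2
        · exact hA _ (memA q h2) _ (memA p (by omega)) h d
        · rcases lt_or_gt_of_ne hpA with h3 | h3
          · exact hAB _ (memA p h3) _ (memB q h2 hq) d c
          · exact hB _ (memB q h2 hq) _ (memB p h3 (by omega)) h d
  have noninv : ∀ p q, p < q → q < w.length → letter w p < letter w q →
      f (letter w p) < f (letter w q) ∨
        ∃ r, p < r ∧ r < q ∧ letter w r = i ∧ letter w p < i ∧ letter w q < i := by
    intro p q hpq hq h
    rcases le_or_gt i (letter w p) with c | c
    · rw [hfix _ c, hfix _ (by omega)]; exact Or.inl h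
    · rcases le_or_gt i (letter w q) with d | d
      · rw [hfix _ d]; have := hlt _ (letter_mem (w := w) (k := p) (by omega)) c; left; omega
      · have hpA : p ≠ A.length := by rintro rfl; omega
        have hqA : q ≠ A.length := by rintro rfl; omega
        rcases lt_or_gt_of_ne hqA with h2 | h2
        · exact Or.inl (hA _ (memA p (by omega)) _ (memA q h2) h d)
        · rcases lt_or_gt_of_ne hpA with h3 | h3
          · exact Or.inr ⟨A.length, h3, h2, eqi, c, d⟩
          · exact Or.inl (hB _ (memB p h3 (by omega)) _ (memB q h2 hq) h d)
  have sep : ∀ p r q, p < r → r < q → q < w.length → letter w r = i → letter w p < i →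
      letter w q < i → f (letter w q) < f (letter w p) := by
    intro p r q hpr hrq hq hr hp hq'
    have := posi r (by omega) hr
    exact hAB _ (memA p (by omega)) _ (memB q (by omega) hq) hp hq'
  refine ⟨⟨by rw [hs, List.length_map], ?_, ?_, ?_, ?_, ?_⟩, ?_⟩
  · intro k hk h; rw [hv k hk, hfix _ h]
  · intro k hk h; rw [hv k hk]; exact (hlt _ (letter_mem hk) h).2
  · intro p q hpq hq h
    rw [hv p (by omega), hv q hq]; exact inv p q hpq hq h
  · intro p q hpq hq h
    rw [hv p (by omega), hv q hq]; exact noninv p q hpq hq h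
  · intro p r q hpr hrq hq hr hp hq'
    rw [hv p (by omega), hv q hq]; exact sep p r q hpr hrq hq hr hp hq'
  -- Every pair of positions has a strictly determined order after the slide, which gives
  -- injectivity and so a permutation again.
  · have hpos : ∀ p q, p < q → q < w.length → f (letter w p) ≠ f (letter w q) := by
      intro p q hpq hq
      rcases lt_trichotomy (letter w p) (letter w q) with h | h | h
      · rcases noninv p q hpq hq h with h' | ⟨r, a, b, c, d, g⟩
        · exact h'.ne
        · exact (sep p r q a b hq c d g).ne'
      · have := letter_inj hnd (by omega) hq h; omega
      · exact (inv p q hpq hq h).ne'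
    rw [hs]
    refine mem_S_of_nodup ?_ (by rw [List.length_map]; exact S.length_eq hw) ?_
    · refine (List.nodup_map_iff_inj_on hnd).2 fun x hx y hy hxy => ?_
      obtain ⟨p, hp, rfl⟩ := exists_letter_eq hx
      obtain ⟨q, hq, rfl⟩ := exists_letter_eq hy
      rcases lt_trichotomy p q with h | h | h
      · exact absurd hxy (hpos p q h hq)
      · rw [h]
      · exact absurd hxy.symm (hpos q p h hp)
    · intro y hy
      obtain ⟨x, hx, rfl⟩ := List.mem_map.1 hy
      have hb := (S.mem_iff hw).1 hx
      rcases le_or_gt i x with h | h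
      · rw [hfix x h]; exact hb
      · have := hlt x hx h; omega

/-- Only a pair below `i` with `i` between can change order. In both words the fixed letter `i` then
exceeds both ends, so neither end condition holds before or after. -/
theorem IsSlide.sameShape {i : ℕ} {w v : List ℕ} (h : IsSlide i w v) (hw : w.Nodup) :
    SameShape w v := by
  refine ⟨h.length_eq, fun p q hpq hq => ⟨⟨fun H k h1 h2 => ?_, fun H k h1 h2 => ?_⟩,
    ⟨fun H k h1 h2 => ?_, fun H k h1 h2 => ?_⟩⟩⟩
  · rcases h.noninv k q h2 hq (H k h1 h2) with h' | ⟨r, a, b, c, -, g⟩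
    · exact h'
    · have := H r (by omega) b; omega
  · have h3 := H k h1 h2
    rcases lt_trichotomy (letter w k) (letter w q) with h' | h' | h'
    · exact h'
    · have := letter_inj hw (by omega) hq h'; omega
    · have := h.inv k q h2 hq h'; omega
  · exact h.inv p k h1 (by omega) (H k h1 h2)
  · have h3 := H k h1 h2
    rcases lt_trichotomy (letter w k) (letter w p) with h' | h' | h'
    · exact h'
    · have := letter_inj hw (by omega) (by omega) h'; omega
    · rcases h.noninv p k h1 (by omega) h' with h'' | ⟨r, a, b, c, d, -⟩
      · omega
      · have h4 := H r a (by omega)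
        rw [h.fixed r (by omega) c.ge] at h4
        have := h.lt p (by omega) d
        omega

/-! ### Sliding removes the pattern 132 -/

/-- No occurrence of the pattern `132` in `w` has the letter `j` as its largest letter. -/
def NoPeak (j : ℕ) (w : List ℕ) : Prop :=
  ∀ p r q, p < r → r < q → q < w.length → letter w r = j → letter w p < j → letter w q < j →
    letter w q < letter w p

theorem IsSlide.noPeak_self {i : ℕ} {w v : List ℕ} (h : IsSlide i w v) : NoPeak i v := by
  intro p r q hpr hrq hq hr hp hq'
  rw [← h.length_eq] at hq
  have lift : ∀ k < w.length, letter v k < i → letter w k < i := fun k hk hv => by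
    by_contra hc
    rw [h.fixed k hk (by omega)] at hv
    omega
  have hr' : letter w r = i := by
    rcases lt_or_ge (letter w r) i with c | c
    · have := h.lt r (by omega) c; omega
    · rw [← h.fixed r (by omega) c, hr]
  exact h.separated p r q hpr hrq hq hr' (lift p (by omega) hp) (lift q hq hq')

/-- The letter `j` and the set of positions with letters below `j` do not change, and the inversions
that the condition demands survive the slide. -/
theorem IsSlide.noPeak_of_lt {i j : ℕ} {w v : List ℕ} (h : IsSlide i w v) (hj : i < j)
    (hw : NoPeak j w) : NoPeak j v := by
  intro p r q hpr hrq hq hr hp hq'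
  rw [← h.length_eq] at hq
  have lift : ∀ k < w.length, letter v k < j → letter w k < j := fun k hk hv => by
    by_contra hc
    rw [h.fixed k hk (by omega)] at hv
    omega
  have hr' : letter w r = j := by
    rcases lt_or_ge (letter w r) i with c | c
    · have := h.lt r (by omega) c; omega
    · rw [← h.fixed r (by omega) c, hr]
  exact h.inv p q (by omega) hq
    (hw p r q hpr hrq hq hr' (lift p (by omega) hp) (lift q hq hq'))

/-- The fold applies the largest index first, so absence of peaks accumulates downwards from `n`. -/
theorem foldr_swuAt_range' {n : ℕ} {w : List ℕ} (hw : w ∈ S n) (m i : ℕ) (hi : 1 ≤ i)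
    (hm : i + m = n + 1) :
    (List.range' i m).foldr swuAt w ∈ S n ∧ SameShape w ((List.range' i m).foldr swuAt w) ∧
      ∀ j, i ≤ j → j ≤ n → NoPeak j ((List.range' i m).foldr swuAt w) := by
  induction m generalizing i with
  | zero => exact ⟨hw, SameShape.refl w, fun j h1 h2 => by omega⟩
  | succ m ih =>
    obtain ⟨h1, h2, h3⟩ := ih (i + 1) (by omega) (by omega)
    rw [List.range'_succ, List.foldr_cons]
    obtain ⟨hs, hS⟩ := isSlide_swuAt h1 hi (by omega)
    refine ⟨hS, h2.trans (hs.sameShape (S.nodup h1)), fun j hj hjn => ?_⟩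
    rcases hj.eq_or_lt with rfl | hj
    · exact hs.noPeak_self
    · exact hs.noPeak_of_lt hj (h3 j hj hjn)

/-- Positional form of avoidance of `132`. -/
def Avoids132 (w : List ℕ) : Prop :=
  ∀ p r q, p < r → r < q → q < w.length → letter w p < letter w q → letter w r ≤ letter w q

theorem swu_spec {n : ℕ} {w : List ℕ} (hw : w ∈ S n) :
    swu w ∈ S n ∧ SameShape w (swu w) ∧ Avoids132 (swu w) := by
  have key := foldr_swuAt_range' hw n 1 le_rfl (by omega)
  have e' : swu w = (List.range' 1 n).foldr swuAt w := by rw [swu, S.length_eq hw]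
  rw [← e'] at key
  refine ⟨key.1, key.2.1, fun p r q hpr hrq hq h => ?_⟩
  by_contra hc
  have hr := (S.mem_iff key.1).1 (letter_mem (w := swu w) (k := r) (by omega))
  have := key.2.2 _ hr.1 hr.2 p r q hpr hrq hq rfl (by omega) (by omega)
  omega

/-- The inner reversals cancel in the composition. -/
theorem swd_eq (w : List ℕ) : swd w = (swu w.reverse).reverse := by
  have aux : ∀ (l : List ℕ) (v : List ℕ),
      l.foldr swdAt v = (l.foldr swuAt v.reverse).reverse := by
    intro l v
    induction l with
    | nil => simp
    | cons i l ih => simp [swdAt, ih]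
  simp [swd, swu, aux]

theorem swd_spec {n : ℕ} {w : List ℕ} (hw : w ∈ S n) :
    swd w ∈ S n ∧ SameShape w (swd w) ∧ Avoids132 (swd w).reverse := by
  obtain ⟨h1, h2, h3⟩ := swu_spec (S.reverse hw)
  rw [swd_eq]
  refine ⟨S.reverse h1, by simpa using h2.reverse, by simpa using h3⟩

/-! ### Uniqueness of the avoiding permutation of a given shape -/

theorem eq_of_letter_lt_iff {n : ℕ} {w v : List ℕ} (hw : w ∈ S n) (hv : v ∈ S n)
    (h : ∀ p < n, ∀ q < n, letter w p < letter w q ↔ letter v p < letter v q) : w = v := by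
  have count : ∀ u ∈ S n, ∀ q < n,
      letter u q - 1 = (List.range n).countP (fun p => decide (letter u p < letter u q)) := by
    intro u hu q hq
    have hl := S.length_eq hu
    have hm := (S.mem_iff hu).1 (letter_mem (w := u) (k := q) (by omega))
    have e : (List.range n).map (letter u) = u := by
      apply List.ext_getElem (by simp [hl])
      intro k h1 h2
      simp [h2]
    rw [← S.countP_lt hu hm.1 hm.2]
    -- Shields this letter from the next rewrite, which replaces `u` by its list of letters.
    generalize letter u q = x
    conv_lhs => rw [← e]
    rw [List.countP_map]
    rfl
  have hlw := S.length_eq hw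
  have hlv := S.length_eq hv
  apply List.ext_getElem (by omega)
  intro q h1 h2
  rw [← letter_eq_getElem h1, ← letter_eq_getElem h2]
  have c1 := count w hw q (by omega)
  have c2 := count v hv q (by omega)
  have c3 : (List.range n).countP (fun p => decide (letter w p < letter w q)) =
      (List.range n).countP (fun p => decide (letter v p < letter v q)) := by
    refine List.countP_congr fun p hp => ?_
    simp only [decide_eq_true_eq]
    exact h p (List.mem_range.1 hp) q (by omega)
  have m1 := (S.mem_iff hw).1 (letter_mem h1)
  have m2 := (S.mem_iff hv).1 (letter_mem h2)
  omega

/-- A larger letter between the two would complete a 132. Thus right-end maxima, hence the shape,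
determine all comparisons. -/
theorem Avoids132.letter_lt_iff {w : List ℕ} (h : Avoids132 w) (hw : w.Nodup) {p q : ℕ}
    (hpq : p < q) (hq : q < w.length) :
    letter w p < letter w q ↔ ∀ k, p ≤ k → k < q → letter w k < letter w q := by
  refine ⟨fun H k h1 h2 => ?_, fun H => H p le_rfl hpq⟩
  rcases h1.eq_or_lt with rfl | h1
  · exact H
  · refine lt_of_le_of_ne (h p k q h1 h2 hq H) fun hc => ?_
    have := letter_inj hw (by omega) hq hc
    omega

theorem SameShape.eq_of_avoids132 {n : ℕ} {w v : List ℕ} (h : SameShape w v) (hw : w ∈ S n)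
    (hv : v ∈ S n) (aw : Avoids132 w) (av : Avoids132 v) : w = v := by
  have hlw := S.length_eq hw
  have hlv := S.length_eq hv
  have key : ∀ p q, p < q → q < n → (letter w p < letter w q ↔ letter v p < letter v q) := by
    intro p q hpq hq
    rw [aw.letter_lt_iff (S.nodup hw) hpq (by omega), av.letter_lt_iff (S.nodup hv) hpq (by omega)]
    exact (h.2 p q hpq (by omega)).1
  refine eq_of_letter_lt_iff hw hv fun p hp q hq => ?_
  rcases lt_trichotomy p q with c | rfl | c
  · exact key p q c hq
  · simp
  · have := key q p c hp
    have n1 : letter w p ≠ letter w q := fun hc => by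
      have := letter_inj (S.nodup hw) (by omega) (by omega) hc; omega
    have n2 : letter v p ≠ letter v q := fun hc => by
      have := letter_inj (S.nodup hv) (by omega) (by omega) hc; omega
    omega

theorem SameShape.eq_of_avoids132_reverse {n : ℕ} {w v : List ℕ} (h : SameShape w v) (hw : w ∈ S n)
    (hv : v ∈ S n) (aw : Avoids132 w.reverse) (av : Avoids132 v.reverse) : w = v :=
  List.reverse_injective
    (h.reverse.eq_of_avoids132 (S.reverse hw) (S.reverse hv) aw av)

/-! ### Pattern containment in terms of positions -/

theorem sublist_triple_iff {w : List ℕ} {a b c : ℕ} :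
    List.Sublist [a, b, c] w ↔ ∃ p r q, p < r ∧ r < q ∧ q < w.length ∧
      letter w p = a ∧ letter w r = b ∧ letter w q = c := by
  constructor
  · intro h
    obtain ⟨is, e, hp⟩ := List.sublist_eq_map_getElem h
    match is, e, hp with
    | [p, r, q], e, hp =>
      simp only [List.map_cons, List.map_nil, List.cons.injEq, and_true] at e
      simp only [List.pairwise_cons, List.mem_cons, List.not_mem_nil, or_false, forall_eq_or_imp,
        forall_eq] at hp
      refine ⟨p, r, q, hp.1.1, hp.2.1, q.2, ?_, ?_, ?_⟩
      · rw [letter_eq_getElem p.2]; exact e.1.symm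
      · rw [letter_eq_getElem r.2]; exact e.2.1.symm
      · rw [letter_eq_getElem q.2]; exact e.2.2.symm
  · rintro ⟨p, r, q, hpr, hrq, hq, rfl, rfl, rfl⟩
    have := List.map_getElem_sublist (l := w)
      (is := [⟨p, by omega⟩, ⟨r, by omega⟩, ⟨q, hq⟩])
      (by simp; omega)
    rw [letter_eq_getElem hq, letter_eq_getElem (hrq.trans hq),
      letter_eq_getElem ((hpr.trans hrq).trans hq)]
    exact this

theorem normalize_triple (a b c : ℕ) : (normalize [a, b, c] = normalize [1, 3, 2] ↔ a < c ∧ c < b) ∧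
    (normalize [a, b, c] = normalize [2, 3, 1] ↔ c < a ∧ a < b) := by
  have e1 : normalize [1, 3, 2] = [1, 3, 2] := by decide
  have e2 : normalize [2, 3, 1] = [2, 3, 1] := by decide
  rw [e1, e2]
  simp only [normalize, List.map_cons, List.map_nil, List.countP_cons, List.countP_nil,
    decide_eq_true_eq, List.cons.injEq, and_true, le_refl, if_true]
  -- Each comparison becomes a 0/1 unknown tied to its inequality, leaving a linear problem for
  -- `omega`.
  have ite_le : ∀ x y : ℕ, ((if x ≤ y then 1 else 0 : ℕ) = 1 ∧ x ≤ y) ∨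
      ((if x ≤ y then 1 else 0 : ℕ) = 0 ∧ y < x) := by
    intro x y
    split_ifs <;> omega
  have h1 := ite_le a b
  have h2 := ite_le b a
  have h3 := ite_le a c
  have h4 := ite_le c a
  have h5 := ite_le b c
  have h6 := ite_le c b
  generalize (if a ≤ b then 1 else 0 : ℕ) = t1 at *
  generalize (if b ≤ a then 1 else 0 : ℕ) = t2 at *
  generalize (if a ≤ c then 1 else 0 : ℕ) = t3 at *
  generalize (if c ≤ a then 1 else 0 : ℕ) = t4 at *
  generalize (if b ≤ c then 1 else 0 : ℕ) = t5 at *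
  generalize (if c ≤ b then 1 else 0 : ℕ) = t6 at *
  omega

theorem exists_triple_of_normalize_eq {u : List ℕ} {x y z : ℕ}
    (h : normalize u = normalize [x, y, z]) : ∃ a b c, u = [a, b, c] := by
  have := congrArg List.length h
  simp only [normalize, List.length_map, List.length_cons, List.length_nil] at this
  exact List.length_eq_three.1 this

theorem contains_132_iff {w : List ℕ} : Contains w [1, 3, 2] ↔ ¬ Avoids132 w := by
  constructor
  · rintro ⟨u, hu, e⟩ H
    obtain ⟨a, b, c, rfl⟩ := exists_triple_of_normalize_eq e
    obtain ⟨p, r, q, hpr, hrq, hq, rfl, rfl, rfl⟩ := sublist_triple_iff.1 hu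
    have h := (normalize_triple _ _ _).1.1 e
    have := H p r q hpr hrq hq h.1
    omega
  · intro H
    simp only [Avoids132, not_forall, not_le] at H
    obtain ⟨p, r, q, hpr, hrq, hq, h1, h2⟩ := H
    exact ⟨_, sublist_triple_iff.2 ⟨p, r, q, hpr, hrq, hq, rfl, rfl, rfl⟩,
      (normalize_triple _ _ _).1.2 ⟨h1, h2⟩⟩

theorem contains_231_iff {w : List ℕ} : Contains w [2, 3, 1] ↔ ¬ Avoids132 w.reverse := by
  rw [← contains_132_iff]
  constructor
  · rintro ⟨u, hu, e⟩
    obtain ⟨a, b, c, rfl⟩ := exists_triple_of_normalize_eq e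
    exact ⟨[c, b, a], List.reverse_sublist.2 hu,
      (normalize_triple _ _ _).1.2 ((normalize_triple _ _ _).2.1 e)⟩
  · rintro ⟨u, hu, e⟩
    obtain ⟨a, b, c, rfl⟩ := exists_triple_of_normalize_eq e
    refine ⟨[c, b, a], ?_, (normalize_triple _ _ _).2.2 ((normalize_triple _ _ _).1.1 e)⟩
    simpa using List.reverse_sublist.2 hu

theorem mem_Av_132_iff {w : List ℕ} : w ∈ Av [1, 3, 2] ↔ (∃ n, w ∈ S n) ∧ Avoids132 w := by
  change _ ∧ _ ↔ _
  rw [contains_132_iff, not_not]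

theorem mem_Av_231_iff {w : List ℕ} :
    w ∈ Av [2, 3, 1] ↔ (∃ n, w ∈ S n) ∧ Avoids132 w.reverse := by
  change _ ∧ _ ↔ _
  rw [contains_231_iff, not_not]

/-! ### The bijections -/

theorem fertility_swu {n : ℕ} {w : List ℕ} (hw : w ∈ S n) : fertility (swu w) = fertility w :=
  have h := swu_spec hw
  (h.2.1.fertility_eq (S.isPerm hw) (S.isPerm h.1)).symm

theorem fertility_swd {n : ℕ} {w : List ℕ} (hw : w ∈ S n) : fertility (swd w) = fertility w :=
  have h := swd_spec hw
  (h.2.1.fertility_eq (S.isPerm hw) (S.isPerm h.1)).symm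

theorem mapsTo_swu_Av : Set.MapsTo swu (Av [2, 3, 1]) (Av [1, 3, 2]) := by
  rintro w ⟨⟨n, hw⟩, -⟩
  have h := swu_spec hw
  exact mem_Av_132_iff.2 ⟨⟨n, h.1⟩, h.2.2⟩

theorem mapsTo_swd_Av : Set.MapsTo swd (Av [1, 3, 2]) (Av [2, 3, 1]) := by
  rintro w ⟨⟨n, hw⟩, -⟩
  have h := swd_spec hw
  exact mem_Av_231_iff.2 ⟨⟨n, h.1⟩, h.2.2⟩

/-- The composite keeps the shape and lands in the avoidance class of the original word, where the
shape has only one member. -/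
theorem invOn_swd_swu_Av : Set.InvOn swd swu (Av [2, 3, 1]) (Av [1, 3, 2]) := by
  constructor
  · intro w hw
    obtain ⟨⟨n, hw⟩, ha⟩ := mem_Av_231_iff.1 hw
    have h := swu_spec hw
    have h' := swd_spec h.1
    exact ((h.2.1.trans h'.2.1).eq_of_avoids132_reverse hw h'.1 ha h'.2.2).symm
  · intro w hw
    obtain ⟨⟨n, hw⟩, ha⟩ := mem_Av_132_iff.1 hw
    have h := swd_spec hw
    have h' := swu_spec h.1
    exact ((h.2.1.trans h'.2.1).eq_of_avoids132 hw h'.1 ha h'.2.2).symm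

theorem mapsTo_swu_U (n : ℕ) : Set.MapsTo swu (U n [2, 3, 1]) (U n [1, 3, 2]) :=
  fun _ ⟨hw, hu, ha⟩ => ⟨(swu_spec hw).1, (fertility_swu hw).trans hu, mapsTo_swu_Av ha⟩

theorem mapsTo_swd_U (n : ℕ) : Set.MapsTo swd (U n [1, 3, 2]) (U n [2, 3, 1]) :=
  fun _ ⟨hw, hu, ha⟩ => ⟨(swd_spec hw).1, (fertility_swd hw).trans hu, mapsTo_swd_Av ha⟩

theorem invOn_swd_swu_U (n : ℕ) : Set.InvOn swd swu (U n [2, 3, 1]) (U n [1, 3, 2]) :=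
  invOn_swd_swu_Av.mono (fun _ h => h.2.2) (fun _ h => h.2.2)

end StackSliding

theorem theorem3 :
    (∀ k : ℕ,
      Set.BijOn StackSliding.swu
        (StackSliding.U (2 * k + 1) [2, 3, 1]) (StackSliding.U (2 * k + 1) [1, 3, 2]) ∧
      Set.BijOn StackSliding.swd
        (StackSliding.U (2 * k + 1) [1, 3, 2]) (StackSliding.U (2 * k + 1) [2, 3, 1]) ∧
      Set.InvOn StackSliding.swd StackSliding.swu
        (StackSliding.U (2 * k + 1) [2, 3, 1]) (StackSliding.U (2 * k + 1) [1, 3, 2])) ∧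
    (Set.BijOn StackSliding.swu (StackSliding.Av [2, 3, 1]) (StackSliding.Av [1, 3, 2]) ∧
      Set.BijOn StackSliding.swd (StackSliding.Av [1, 3, 2]) (StackSliding.Av [2, 3, 1]) ∧
      Set.InvOn StackSliding.swd StackSliding.swu
        (StackSliding.Av [2, 3, 1]) (StackSliding.Av [1, 3, 2])) ∧
    (∀ (n : ℕ) (π : List ℕ), π ∈ StackSliding.S n →
      StackSliding.Des (StackSliding.swu π) = StackSliding.Des π ∧
      StackSliding.Des (StackSliding.swd π) = StackSliding.Des π ∧
      (StackSliding.Sorted π →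
        StackSliding.Sorted (StackSliding.swu π) ∧ StackSliding.Sorted (StackSliding.swd π))) := by
  refine ⟨fun k => ?_, ?_, fun n π hπ => ?_⟩
  · exact ⟨(StackSliding.invOn_swd_swu_U _).bijOn (StackSliding.mapsTo_swu_U _)
        (StackSliding.mapsTo_swd_U _),
      (StackSliding.invOn_swd_swu_U _).symm.bijOn (StackSliding.mapsTo_swd_U _)
        (StackSliding.mapsTo_swu_U _), StackSliding.invOn_swd_swu_U _⟩
  · exact ⟨StackSliding.invOn_swd_swu_Av.bijOn StackSliding.mapsTo_swu_Av
        StackSliding.mapsTo_swd_Av,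
      StackSliding.invOn_swd_swu_Av.symm.bijOn StackSliding.mapsTo_swd_Av
        StackSliding.mapsTo_swu_Av, StackSliding.invOn_swd_swu_Av⟩
  · refine ⟨(StackSliding.swu_spec hπ).2.1.des_eq.symm, (StackSliding.swd_spec hπ).2.1.des_eq.symm,
      fun hs => ⟨?_, ?_⟩⟩
    · rw [StackSliding.Sorted, StackSliding.fertility_swu hπ]; exact hs
    · rw [StackSliding.Sorted, StackSliding.fertility_swd hπ]; exact hs
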